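/- Let $G$ be a finite simple graph with vertex set $V$ and shortest-path distance $d$, where $d(a,b)=\infty$ if $a$ and $b$ lie in different connected components. For integers $k,\ell\ge 0$ let $EMC_{k,\ell}(G)$ be the free abelian group on all tuples $(v_0,\dots,v_k)\in V^{k+1}$ of pairwise distinct vertices such that $d(v_i,v_{i+1})<\infty$ for $0\le i<k$ and $\sum_{i=0}^{k-1}d(v_i,v_{i+1})=\ell$. Let $\partial_{k,\ell}\colon EMC_{k,\ell}(G)\to EMC_{k-1,\ell}(G)$ be the homomorphism $$\partial_{k,\ell}(v_0,\dots,v_k)=\sum_{i=1}^{k-1}(-1)^i\,\partial^i_{k,\ell}(v_0,\dots,v_k),$$ where $\partial^i_{k,\ell}(v_0,\dots,v_k)$ is the tuple obtained by removing $v_i$ if that tuple still has length $\ell$, and $0$ otherwise (and $\partial_{0,\ell}=0$). Then $\partial_{k,\ell}\circ\partial_{k+1,\ell}=0$, and the Eulerian magnitude homology of $G$ is $EMH_{k,\ell}(G)=\ker\partial_{k,\ell}/\operatorname{im}\partial_{k+1,\ell}$. Theorem. For every finitely generated abelian group $A$ (equivalently, every group $A=\mathbb{Z}^r\oplus\mathbb{Z}_{p_1^{r_1}}\oplus\cdots\oplus\mathbb{Z}_{p_n^{r_n}}$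 with $p_i$ prime) there exist a finite graph $G$ and positive integers $k,\ell$ such that $A$ is isomorphic to a subgroup of $EMH_{k,\ell}(G)$. -/

import Mathlib

/-!
# Eulerian magnitude homology of a graph

Tuples of `k + 1` vertices are functions `Fin (k + 1) → V`; the distance of a graph is Mathlib's
`SimpleGraph.edist`, with value `⊤` between vertices in different components.
-/

namespace EulerianMagnitude

variable {V : Type*} (G : SimpleGraph V)

/-- A `k`-path: consecutive vertices are distinct and at finite distance. -/
def IsKPath {k : ℕ} (v : Fin (k + 1) → V) : Prop :=
  ∀ i : Fin k, v i.castSucc ≠ v i.succ ∧ G.edist (v i.castSucc) (v i.succ) < ⊤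

/-- The length of a tuple: the sum of the distances of consecutive vertices. -/
noncomputable def len {k : ℕ} (v : Fin (k + 1) → V) : ℕ∞ :=
  ∑ i : Fin k, G.edist (v i.castSucc) (v i.succ)

/-- An Eulerian `k`-path: a `k`-path without repeated vertices. -/
def IsEulerianPath {k : ℕ} (v : Fin (k + 1) → V) : Prop :=
  IsKPath G v ∧ Function.Injective v

/-- The Eulerian `k`-paths of length `ℓ`. -/
abbrev EulerianPath (k ℓ : ℕ) : Type _ :=
  {v : Fin (k + 1) → V // IsEulerianPath G v ∧ len G v = ℓ}

/-- The Eulerian magnitude chain group: the free abelian group on the Eulerian `k`-paths of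
length `ℓ`. -/
abbrev EMC (k ℓ : ℕ) : Type _ := EulerianPath G k ℓ →₀ ℤ

/-- For a tuple `(v_0, …, v_{k+1})` and `i ∈ {0, …, k-1}`, remove the interior vertex
`v_{i+1}`. -/
def face {k : ℕ} (i : Fin k) (v : Fin (k + 2) → V) : Fin (k + 1) → V :=
  i.castSucc.succ.removeNth v

variable {G}

theorem len_succ {k : ℕ} (v : Fin (k + 2) → V) :
    len G v = G.edist (v 0) (v 1) + len G (Fin.tail v) := by
  simp [len, Fin.sum_univ_succ, Fin.tail]

theorem len_face_le {k : ℕ} (i : Fin k) (v : Fin (k + 2) → V) :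
    len G (face i v) ≤ len G v := by
  induction k with
  | zero => exact i.elim0
  | succ k ih =>
    rw [len_succ, len_succ v]
    refine Fin.cases ?_ (fun j => ?_) i
    · rw [len_succ (Fin.tail v), ← add_assoc]
      exact add_le_add G.edist_triangle le_rfl
    · have h0 : face j.succ v 0 = v 0 := rfl
      have h1 : face j.succ v 1 = v 1 := by
        simp [face, Fin.removeNth, Fin.succAbove, Fin.lt_def]
      have h2 : Fin.tail (face j.succ v) = face j (Fin.tail v) := by
        funext x
        simp [face, Fin.removeNth, Fin.tail]
      rw [h0, h1, h2]
      gcongr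
      exact ih j _

theorem IsEulerianPath.edist_lt_top {k : ℕ} {v : Fin (k + 1) → V} (hv : IsEulerianPath G v)
    (a b : Fin (k + 1)) : G.edist (v a) (v b) < ⊤ := by
  have h0 : ∀ a, G.edist (v 0) (v a) < ⊤ := by
    intro a
    induction a using Fin.induction with
    | zero => simp
    | succ i ih => exact lt_of_le_of_lt G.edist_triangle (WithTop.add_lt_top.2 ⟨ih, (hv.1 i).2⟩)
  exact lt_of_le_of_lt G.edist_triangle
    (WithTop.add_lt_top.2 ⟨(G.edist_comm (u := v a) (v := v 0)).symm ▸ h0 a, h0 b⟩)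

theorem IsEulerianPath.face {k : ℕ} {v : Fin (k + 2) → V} (hv : IsEulerianPath G v)
    (i : Fin k) : IsEulerianPath G (face i v) := by
  have hinj : Function.Injective (EulerianMagnitude.face i v) :=
    hv.2.comp Fin.succAbove_right_injective
  refine ⟨fun j => ⟨fun h => ?_, hv.edist_lt_top _ _⟩, hinj⟩
  have := congrArg Fin.val (hinj h)
  simp at this

variable (G)

open Classical in
/-- The `i`-th face of a generator: the path with the interior vertex `v_{i+1}` removed if this
still has length `ℓ`, and `0` otherwise. -/
noncomputable def faceChain {k ℓ : ℕ} (i : Fin k) (v : EulerianPath G (k + 1) ℓ) : EMC G k ℓ :=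
  if h : len G (face i v.1) = ℓ then Finsupp.single ⟨face i v.1, v.2.1.face i, h⟩ 1 else 0

/-- The boundary map from degree `k + 1` to degree `k`: the alternating sum over the interior
vertices `v_1, …, v_k` of `(v_0, …, v_{k+1})`. -/
noncomputable def boundary (k ℓ : ℕ) : EMC G (k + 1) ℓ →ₗ[ℤ] EMC G k ℓ :=
  Finsupp.lift (EMC G k ℓ) ℤ (EulerianPath G (k + 1) ℓ)
    (fun v => ∑ i : Fin k, (-1 : ℤ) ^ ((i : ℕ) + 1) • faceChain G i v)

variable {G}

theorem boundary_single {k ℓ : ℕ} (v : EulerianPath G (k + 1) ℓ) :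
    boundary G k ℓ (Finsupp.single v 1) =
      ∑ i : Fin k, (-1 : ℤ) ^ ((i : ℕ) + 1) • faceChain G i v := by
  simp [boundary]

/-- Simplicial identity for interior faces. -/
theorem face_face {k : ℕ} (i : Fin (k + 1)) (j : Fin k) (h : (j : ℕ) < i)
    (v : Fin (k + 3) → V) :
    face j (face i v) = face (⟨i - 1, by omega⟩ : Fin k) (face j.castSucc v) := by
  funext x
  simp only [face, Fin.removeNth]
  congr 1
  ext
  simp only [Fin.succAbove, Fin.lt_def]
  split_ifs <;> simp_all <;> omega

open Classical in
theorem boundary_boundary_single {k ℓ : ℕ} (v : EulerianPath G (k + 2) ℓ) :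
    boundary G k ℓ (boundary G (k + 1) ℓ (Finsupp.single v 1)) = 0 := by
  let T : (Fin (k + 1) → V) → EMC G k ℓ := fun w =>
    if h : IsEulerianPath G w ∧ len G w = ℓ then Finsupp.single ⟨w, h⟩ 1 else 0
  have key : ∀ i : Fin (k + 1), boundary G k ℓ (faceChain G i v) =
      ∑ j : Fin k, (-1 : ℤ) ^ ((j : ℕ) + 1) • T (face j (face i v.1)) := by
    intro i
    have hE := v.2.1.face i
    by_cases h : len G (face i v.1) = ℓ
    · rw [faceChain, dif_pos h, boundary_single]
      refine Finset.sum_congr rfl fun j _ => ?_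
      congr 1
      by_cases h' : len G (face j (face i v.1)) = ℓ
      · simp only [T]
        rw [faceChain, dif_pos h', dif_pos ⟨hE.face j, h'⟩]
      · simp only [T]
        rw [faceChain, dif_neg h', dif_neg fun h'' => h' h''.2]
    · rw [faceChain, dif_neg h, map_zero]
      symm
      refine Finset.sum_eq_zero fun j _ => ?_
      have hlt : len G (face i v.1) < ℓ :=
        lt_of_le_of_ne ((len_face_le i v.1).trans_eq v.2.2) h
      simp only [T]
      rw [dif_neg fun h'' => (lt_of_le_of_lt (len_face_le j _) hlt).ne h''.2, smul_zero]
  rw [boundary_single, map_sum]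
  simp only [map_smul, key, Finset.smul_sum, smul_smul, ← pow_add]
  rw [← Finset.sum_product', Finset.univ_product_univ]
  refine Finset.sum_involution
    (fun p _ => if h : (p.2 : ℕ) < p.1 then (p.2.castSucc, ⟨p.1 - 1, by omega⟩)
      else (p.2.succ, ⟨p.1, by omega⟩)) ?_ ?_ ?_ ?_
  · rintro ⟨i, j⟩ -
    by_cases h : (j : ℕ) < i
    · simp only [h, dif_pos]
      rw [face_face i j h, ← add_smul]
      have e : (i : ℕ) + 1 + (j + 1) = ((j.castSucc : Fin (k + 1)) : ℕ) + 1 + (i - 1 + 1) + 1 := by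
        simp; omega
      rw [e, pow_succ]
      simp
    · simp only [h, dif_neg, not_false_iff]
      rw [face_face j.succ ⟨i, by omega⟩ (by simp; omega)]
      have e1 : (⟨(j.succ : Fin (k + 1)) - 1, by simp⟩ : Fin k) = j := by ext; simp
      have e2 : (⟨i, by omega⟩ : Fin k).castSucc = i := by ext; simp
      rw [e1, e2, ← add_smul]
      have e : ((j.succ : Fin (k + 1)) : ℕ) + 1 + (i + 1) = (i : ℕ) + 1 + (j + 1) + 1 := by
        simp; omega
      simp only [e]
      rw [pow_succ]
      simp
  · rintro ⟨i, j⟩ - -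
    by_cases h : (j : ℕ) < i
    · simp only [h, dif_pos, ne_eq, Prod.mk.injEq, Fin.ext_iff]
      simp; omega
    · simp only [h, dif_neg, not_false_iff, ne_eq, Prod.mk.injEq, Fin.ext_iff]
      simp; omega
  · intros; simp
  · rintro ⟨i, j⟩ -
    by_cases h : (j : ℕ) < i
    · have : ¬ ((i : ℕ) - 1 < j) := by omega
      simp [h, this, Fin.ext_iff]
      omega
    · have : (i : ℕ) < j + 1 := by omega
      simp [h, this, Fin.ext_iff]

theorem boundary_comp_boundary (k ℓ : ℕ) :
    boundary G k ℓ ∘ₗ boundary G (k + 1) ℓ = 0 := by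
  refine Finsupp.lhom_ext' fun v => LinearMap.ext_ring ?_
  simpa using boundary_boundary_single v

variable (G)

/-- The cycles: the kernel of the boundary map out of degree `k`, which is zero for `k = 0`. -/
noncomputable def cycles : (k ℓ : ℕ) → Submodule ℤ (EMC G k ℓ)
  | 0, _ => ⊤
  | k + 1, ℓ => LinearMap.ker (boundary G k ℓ)

theorem boundary_mem_cycles (k ℓ : ℕ) (c : EMC G (k + 1) ℓ) :
    boundary G k ℓ c ∈ cycles G k ℓ := by
  cases k with
  | zero => trivial
  | succ k => exact LinearMap.congr_fun (boundary_comp_boundary k ℓ) c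

/-- The Eulerian magnitude homology group: the kernel of the boundary map out of degree `k` modulo
the image of the boundary map out of degree `k + 1`. -/
abbrev EMH (k ℓ : ℕ) : Type _ :=
  cycles G k ℓ ⧸ LinearMap.range ((boundary G k ℓ).codRestrict (cycles G k ℓ)
    (boundary_mem_cycles G k ℓ))

end EulerianMagnitude

/-! The graph is the Hasse diagram of a ranked set with a bottom, three middle levels and a top. A
path of length 4 from bottom to top must climb, and deleting an interior vertex keeps its length, so
such paths span a complex of chains in the middle levels. Thus `EMH 3 4` sees first homology of a
2-dimensional complex, and it suffices to put the group `A` inside that homology.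

Write `A` as a free group times a finite group `T`. Each free generator and each `t : T` gets a
loop. Every position `ι i` gives an open path from `base` through `node i` to `apex`, and whenever
`ι k = ι i + lam j` the loop of `j` is homologous to the path of `i` minus that of `k`
(`mkQ_loopChain`). Telescoping makes loop classes additive on `T` (`loopClass_add`), so there is a
homomorphism from `A` to homology. It is injective because an `A`-valued cocycle
(`cocycle_comp_boundary`) takes the value `lam j` on the loop of `j` (`cocycle_loopChain`), which
gives a left inverse. -/

namespace EulerianMagnitude

/-! ### Rank functions as lower bounds for length -/

section RankedGraph

variable {V : Type*} {G : SimpleGraph V}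

theorem le_add_edist_of_adj {r : V → ℕ} (hr : ∀ u v, G.Adj u v → r v ≤ r u + 1) (u v : V) :
    (r v : ℕ∞) ≤ r u + G.edist u v := by
  have hw : ∀ {u v : V} (p : G.Walk u v), r v ≤ r u + p.length := by
    intro u v p
    induction p with
    | nil => simp
    | cons h p ih =>
      have := hr _ _ h
      rw [SimpleGraph.Walk.length_cons]
      omega
  by_cases h : G.edist u v = ⊤
  · simp [h]
  · obtain ⟨p, hp⟩ := SimpleGraph.exists_walk_of_edist_ne_top h
    rw [← hp]
    exact_mod_cast hw p

theorem le_add_len {r : V → ℕ} (hr : ∀ u v, G.Adj u v → r v ≤ r u + 1) {k : ℕ}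
    (v : Fin (k + 1) → V) : (r (v (Fin.last k)) : ℕ∞) ≤ r (v 0) + len G v := by
  induction k with
  | zero => simp
  | succ k ih =>
    rw [len_succ, ← add_assoc]
    exact (ih (Fin.tail v)).trans (add_le_add (le_add_edist_of_adj hr _ _) le_rfl)

theorem isEulerianPath_of_strictMono {r : V → ℕ} {k ℓ : ℕ} {v : Fin (k + 1) → V}
    (hmono : StrictMono (r ∘ v)) (hlen : len G v = ℓ) : IsEulerianPath G v := by
  have hinj : Function.Injective v := hmono.injective.of_comp
  refine ⟨fun i => ⟨fun h => i.castSucc_lt_succ.ne (hinj h), ?_⟩, hinj⟩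
  have h1 : G.edist (v i.castSucc) (v i.succ) ≤ len G v :=
    Finset.single_le_sum (f := fun i : Fin k => G.edist (v i.castSucc) (v i.succ))
      (fun _ _ => zero_le) (Finset.mem_univ i)
  rw [hlen] at h1
  exact lt_of_le_of_lt h1 (ENat.natCast_lt_top ℓ)

end RankedGraph

/-! ### Chains from tuples, and evaluation of cocycles on homology -/

section TupleChain

variable {V : Type*} (G : SimpleGraph V)

open Classical in
/-- The generator given by a tuple of vertices, which is `0` unless the tuple is an Eulerian path
of length `ℓ`. -/
noncomputable def tupleChain {k : ℕ} (ℓ : ℕ) (v : Fin (k + 1) → V) : EMC G k ℓ :=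
  if h : IsEulerianPath G v ∧ len G v = ℓ then Finsupp.single ⟨v, h⟩ 1 else 0

variable {G}

theorem tupleChain_val {k ℓ : ℕ} (v : EulerianPath G k ℓ) :
    tupleChain G ℓ v.1 = Finsupp.single v 1 := dif_pos v.2

theorem faceChain_eq_tupleChain {k ℓ : ℕ} (i : Fin k) (v : EulerianPath G (k + 1) ℓ) :
    faceChain G i v = tupleChain G ℓ (face i v.1) := by
  unfold faceChain tupleChain
  by_cases h : len G (face i v.1) = ℓ
  · rw [dif_pos h, dif_pos ⟨v.2.1.face i, h⟩]
  · rw [dif_neg h, dif_neg fun h' => h h'.2]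

theorem boundary_tupleChain {k ℓ : ℕ} {v : Fin (k + 2) → V}
    (hv : IsEulerianPath G v ∧ len G v = ℓ) :
    boundary G k ℓ (tupleChain G ℓ v) =
      ∑ i : Fin k, (-1 : ℤ) ^ ((i : ℕ) + 1) • tupleChain G ℓ (face i v) := by
  rw [tupleChain_val ⟨v, hv⟩, boundary_single]
  simp only [faceChain_eq_tupleChain]

end TupleChain

section Homology

variable {V : Type*} {G : SimpleGraph V} {k ℓ : ℕ}

/-- The homology class of a cycle. -/
noncomputable def homologyClass : cycles G k ℓ →ₗ[ℤ] EMH G k ℓ := Submodule.mkQ _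

theorem homologyClass_eq_iff {z w : cycles G k ℓ} :
    homologyClass z = homologyClass w ↔
      (z : EMC G k ℓ) - w ∈ LinearMap.range (boundary G k ℓ) := by
  rw [homologyClass, Submodule.mkQ_apply, Submodule.mkQ_apply, Submodule.Quotient.eq]
  simp only [LinearMap.mem_range, Subtype.ext_iff, LinearMap.codRestrict_apply,
    AddSubgroupClass.coe_sub]

/-- The map on homology induced by a cocycle. -/
noncomputable def homologyEval {A : Type*} [AddCommGroup A] (φ : EMC G k ℓ →ₗ[ℤ] A)
    (hφ : φ ∘ₗ boundary G k ℓ = 0) : EMH G k ℓ →ₗ[ℤ] A :=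
  Submodule.liftQ _ (φ ∘ₗ (cycles G k ℓ).subtype) (by
    rintro _ ⟨c, rfl⟩
    exact LinearMap.congr_fun hφ c)

theorem homologyEval_homologyClass {A : Type*} [AddCommGroup A] (φ : EMC G k ℓ →ₗ[ℤ] A)
    (hφ : φ ∘ₗ boundary G k ℓ = 0) (z : cycles G k ℓ) :
    homologyEval φ hφ (homologyClass z) = φ z := rfl

end Homology

/-! ### The ranked graph and its labelling -/

/-- The vertices of the graph realizing a presented group: a bottom, three levels, and a top. -/
inductive Vertex (I J : Type) : Type
  | bot | top
  | apex | base | side (j : J)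
  | node (i : I) | link (j : J) (i : I) | arc (j : J) (ε : Bool)
  | roof (j : J) (i : I) (ε : Bool)

namespace Vertex

variable {I J : Type}

instance [Finite I] [Finite J] : Finite (Vertex I J) := by
  let f : Fin 4 ⊕ J ⊕ I ⊕ (J × I) ⊕ (J × Bool) ⊕ (J × I × Bool) → Vertex I J :=
    Sum.elim ![bot, top, apex, base] <| Sum.elim side <| Sum.elim node <|
      Sum.elim (fun q => link q.1 q.2) <| Sum.elim (fun q => arc q.1 q.2)
        fun q => roof q.1 q.2.1 q.2.2
  refine Finite.of_surjective f fun v => ?_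
  cases v with
  | bot => exact ⟨.inl 0, rfl⟩
  | top => exact ⟨.inl 1, rfl⟩
  | apex => exact ⟨.inl 2, rfl⟩
  | base => exact ⟨.inl 3, rfl⟩
  | side j => exact ⟨.inr (.inl j), rfl⟩
  | node i => exact ⟨.inr (.inr (.inl i)), rfl⟩
  | link j i => exact ⟨.inr (.inr (.inr (.inl (j, i)))), rfl⟩
  | arc j ε => exact ⟨.inr (.inr (.inr (.inr (.inl (j, ε))))), rfl⟩
  | roof j i ε => exact ⟨.inr (.inr (.inr (.inr (.inr (j, i, ε))))), rfl⟩

/-- The level of a vertex. -/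
def rank : Vertex I J → ℕ
  | bot => 0
  | apex | base | side _ => 1
  | node _ | link _ _ | arc _ _ => 2
  | roof _ _ _ => 3
  | top => 4

variable {A : Type*} [AddCommGroup A]

/-- The covering relation between consecutive levels. The loop `base, arc j false, side j,
arc j true` represents `lam j`, and the apex is joined to all positions `ι i`. -/
inductive Cov (ι : I → A) (lam : J → A) : Vertex I J → Vertex I J → Prop
  | bot_apex : Cov ι lam bot apex
  | bot_base : Cov ι lam bot base
  | bot_side (j) : Cov ι lam bot (side j)
  | apex_node (i) : Cov ι lam apex (node i)
  | apex_link (j i) : Cov ι lam apex (link j i)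
  | base_node (i) : Cov ι lam base (node i)
  | base_arc (j ε) : Cov ι lam base (arc j ε)
  | side_arc (j ε) : Cov ι lam (side j) (arc j ε)
  | side_link (j i) : Cov ι lam (side j) (link j i)
  | node_false (j i) : Cov ι lam (node i) (roof j i false)
  -- The only edges that depend on the group law. The equation is what makes the label additive
  -- along `apex`, `node k`, `roof j i true`.
  | node_true (j i k) (h : ι k = ι i + lam j) : Cov ι lam (node k) (roof j i true)
  | link_roof (j i ε) : Cov ι lam (link j i) (roof j i ε)
  | arc_roof (j i ε) : Cov ι lam (arc j ε) (roof j i ε)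
  | roof_top (j i ε) : Cov ι lam (roof j i ε) top

/-- An edge labelling which is additive along chains of the three middle levels. -/
def label (ι : I → A) (lam : J → A) : Vertex I J → Vertex I J → A
  | apex, node i => ι i
  | apex, link _ i => ι i
  | apex, roof _ i _ => ι i
  | base, arc j true => -lam j
  | base, roof j _ true => -lam j
  | node _, roof j _ true => -lam j
  | _, _ => 0

variable {ι : I → A} {lam : J → A} {p q r : Vertex I J}

theorem Cov.rank_eq (h : Cov ι lam p q) : q.rank = p.rank + 1 := by
  cases h <;> rfl

theorem cov_bot (h : p.rank = 1) : Cov ι lam bot p := by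
  cases p <;> simp [rank] at h <;> constructor

theorem cov_top (h : p.rank = 3) : Cov ι lam p top := by
  cases p <;> simp [rank] at h
  constructor

theorem label_add (hpq : Cov ι lam p q) (hqr : Cov ι lam q r) (hp : p.rank = 1) :
    label ι lam p q + label ι lam q r = label ι lam p r := by
  cases hpq <;> simp [rank] at hp <;> cases hqr <;> simp [label]
  case apex_node.node_true h => rw [h]; abel
  case base_arc.arc_roof ε _ => cases ε <;> simp

variable (ι lam)

/-- The graph of the covering relation. -/
def graph : SimpleGraph (Vertex I J) where
  Adj u v := Cov ι lam u v ∨ Cov ι lam v u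
  symm := ⟨fun _ _ h => h.symm⟩
  loopless := ⟨fun v h => by
    rcases h with h | h <;> exact absurd h.rank_eq (by omega)⟩

variable {ι lam}

theorem Cov.adj (h : Cov ι lam p q) : (graph ι lam).Adj p q := .inl h

theorem rank_le_of_adj (u v : Vertex I J) (h : (graph ι lam).Adj u v) : v.rank ≤ u.rank + 1 := by
  rcases h with h | h <;> have := h.rank_eq <;> omega

theorem cov_of_adj (h : (graph ι lam).Adj p q) (hr : p.rank < q.rank) : Cov ι lam p q := by
  rcases h with h | h
  · exact h
  · have := h.rank_eq
    omega

theorem four_le_len {k : ℕ} {v : Fin (k + 1) → Vertex I J} (h0 : v 0 = bot)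
    (h1 : v (Fin.last k) = top) : 4 ≤ len (graph ι lam) v := by
  simpa [h0, h1, rank] using le_add_len rank_le_of_adj v

/-- Ranks force length at least 4 between the endpoints, while faces never lengthen. Hence no term
of the boundary is lost on these paths, and it is the full alternating sum. -/
theorem isEulerianPath_face_of_bot_top {k : ℕ} {v : Fin (k + 2) → Vertex I J}
    (hv : IsEulerianPath (graph ι lam) v ∧ len (graph ι lam) v = (4 : ℕ))
    (h0 : v 0 = bot) (h1 : v (Fin.last (k + 1)) = top) (i : Fin k) :
    IsEulerianPath (graph ι lam) (face i v) ∧ len (graph ι lam) (face i v) = (4 : ℕ) := by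
  refine ⟨hv.1.face i, le_antisymm ((len_face_le i v).trans_eq hv.2) (four_le_len ?_ ?_)⟩
  · rw [← h0]
    rfl
  · rw [← h1, face, Fin.removeNth, Fin.succAbove_of_lt_succ _ _ (by simp [Fin.lt_def]),
      Fin.succ_last]

theorem isEulerianPath_of_cov (hpq : Cov ι lam p q) (hqr : Cov ι lam q r) (hp : p.rank = 1) :
    IsEulerianPath (graph ι lam) ![bot, p, q, r, top] ∧
      len (graph ι lam) ![bot, p, q, r, top] = (4 : ℕ) := by
  have hq := hpq.rank_eq
  have hr := hqr.rank_eq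
  rw [hp] at hq
  rw [hq] at hr
  have hlen : len (graph ι lam) ![bot, p, q, r, top] = (4 : ℕ) := by
    have e1 := SimpleGraph.edist_eq_one_iff_adj.2 (cov_bot (ι := ι) (lam := lam) hp).adj
    have e2 := SimpleGraph.edist_eq_one_iff_adj.2 hpq.adj
    have e3 := SimpleGraph.edist_eq_one_iff_adj.2 hqr.adj
    have e4 := SimpleGraph.edist_eq_one_iff_adj.2 (cov_top (ι := ι) (lam := lam) hr).adj
    simp [len, Fin.sum_univ_succ, e1, e2, e3, e4]
    norm_num
  refine ⟨isEulerianPath_of_strictMono (r := rank) ?_ hlen, hlen⟩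
  rw [Fin.strictMono_iff_lt_succ]
  intro i
  have h0 : (bot : Vertex I J).rank = 0 := rfl
  have h4 : (top : Vertex I J).rank = 4 := rfl
  fin_cases i <;> simp [hp, hq, hr, h0, h4]

/-! ### Points, edges and triangles of the middle levels -/

/-- The chain `(bot, p, top)`. -/
noncomputable def pointChain (ι : I → A) (lam : J → A) (p : Vertex I J) :
    EMC (graph ι lam) 2 4 := tupleChain _ 4 ![bot, p, top]

/-- The chain `(bot, p, q, top)`. -/
noncomputable def edgeChain (ι : I → A) (lam : J → A) (p q : Vertex I J) :
    EMC (graph ι lam) 3 4 := tupleChain _ 4 ![bot, p, q, top]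

/-- The vertex `r` above `q` only serves to exhibit the tuple as a face of a full path. -/
theorem isEulerianPath_edge (hpq : Cov ι lam p q) (hqr : Cov ι lam q r) (hp : p.rank = 1) :
    IsEulerianPath (graph ι lam) ![bot, p, q, top] ∧
      len (graph ι lam) ![bot, p, q, top] = (4 : ℕ) := by
  have h := isEulerianPath_face_of_bot_top (isEulerianPath_of_cov hpq hqr hp) rfl rfl 2
  have e : face (2 : Fin 3) ![bot, p, q, r, top] = ![bot, p, q, top] := by
    funext i
    fin_cases i <;> rfl
  rwa [e] at h

theorem boundary_edgeChain (hpq : Cov ι lam p q) (hqr : Cov ι lam q r) (hp : p.rank = 1) :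
    boundary (graph ι lam) 2 4 (edgeChain ι lam p q) =
      pointChain ι lam p - pointChain ι lam q := by
  have e0 : face (0 : Fin 2) ![bot, p, q, top] = ![bot, q, top] := by
    funext i
    fin_cases i <;> rfl
  have e1 : face (1 : Fin 2) ![bot, p, q, top] = ![bot, p, top] := by
    funext i
    fin_cases i <;> rfl
  rw [edgeChain, boundary_tupleChain (isEulerianPath_edge hpq hqr hp), Fin.sum_univ_two, e0, e1]
  simp only [pointChain, Fin.val_zero, Fin.val_one]
  module

/-- The triangle `p, q, r` is filled. Classes are taken among all chains modulo boundaries, since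
single edges are not cycles. -/
theorem mkQ_edgeChain_add (hpq : Cov ι lam p q) (hqr : Cov ι lam q r) (hp : p.rank = 1) :
    (LinearMap.range (boundary (graph ι lam) 3 4)).mkQ (edgeChain ι lam p q) +
      (LinearMap.range (boundary (graph ι lam) 3 4)).mkQ (edgeChain ι lam q r) =
      (LinearMap.range (boundary (graph ι lam) 3 4)).mkQ (edgeChain ι lam p r) := by
  have e0 : face (0 : Fin 3) ![bot, p, q, r, top] = ![bot, q, r, top] := by
    funext i
    fin_cases i <;> rfl
  have e1 : face (1 : Fin 3) ![bot, p, q, r, top] = ![bot, p, r, top] := by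
    funext i
    fin_cases i <;> rfl
  have e2 : face (2 : Fin 3) ![bot, p, q, r, top] = ![bot, p, q, top] := by
    funext i
    fin_cases i <;> rfl
  rw [← map_add, ← sub_eq_zero, ← map_sub, Submodule.mkQ_apply, Submodule.Quotient.mk_eq_zero]
  -- The sign is needed because the first interior face enters the boundary with sign `-1`.
  refine ⟨-tupleChain _ 4 ![bot, p, q, r, top], ?_⟩
  rw [map_neg, boundary_tupleChain (isEulerianPath_of_cov hpq hqr hp), Fin.sum_univ_three,
    e0, e1, e2]
  simp only [edgeChain, Fin.val_zero, Fin.val_one, Fin.val_two]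
  module

/-! ### The cocycle with values in the group -/

open Classical in
/-- The value of the cocycle on a tuple: the label of the inner edge of a path from the bottom to
the top. -/
noncomputable def tupleLabel (ι : I → A) (lam : J → A) (v : Fin 4 → Vertex I J) : A :=
  if v 0 = bot ∧ v 3 = top then label ι lam (v 1) (v 2) else 0

/-- The cocycle given by the labelling. -/
noncomputable def cocycle (ι : I → A) (lam : J → A) : EMC (graph ι lam) 3 4 →ₗ[ℤ] A :=
  Finsupp.lift A ℤ _ fun v => tupleLabel ι lam v.1

theorem cocycle_tupleChain {v : Fin 4 → Vertex I J}
    (hv : IsEulerianPath (graph ι lam) v ∧ len (graph ι lam) v = (4 : ℕ)) :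
    cocycle ι lam (tupleChain _ 4 v) = tupleLabel ι lam v := by
  rw [tupleChain_val ⟨v, hv⟩]
  simp [cocycle]

/-- Four positive distances with sum 4 all equal 1, and four edges can raise the rank from 0 to 4
only by climbing one level each. -/
theorem cov_of_isEulerianPath {v : Fin 5 → Vertex I J}
    (hv : IsEulerianPath (graph ι lam) v ∧ len (graph ι lam) v = (4 : ℕ))
    (h0 : v 0 = bot) (h1 : v 4 = top) :
    Cov ι lam (v 1) (v 2) ∧ Cov ι lam (v 2) (v 3) ∧ (v 1).rank = 1 := by
  have hne : ∀ i : Fin 4, 1 ≤ (graph ι lam).edist (v i.castSucc) (v i.succ) := fun i =>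
    Order.one_le_iff_pos.2 (SimpleGraph.edist_pos_of_ne (hv.1.1 i).1)
  have hfin : ∀ i : Fin 4, ∃ n : ℕ, (graph ι lam).edist (v i.castSucc) (v i.succ) = n :=
    fun i => ⟨_, (ENat.natCast_toNat (hv.1.1 i).2.ne).symm⟩
  choose d hd using hfin
  have hpos : ∀ i, 1 ≤ d i := fun i => by
    have := hne i
    rw [hd] at this
    exact_mod_cast this
  have hsum : d 0 + d 1 + d 2 + d 3 = 4 := by
    have := hv.2
    simp only [len, hd, Fin.sum_univ_four] at this
    exact_mod_cast this
  have hadj : ∀ i : Fin 4, (graph ι lam).Adj (v i.castSucc) (v i.succ) := fun i => by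
    rw [← SimpleGraph.edist_eq_one_iff_adj, hd]
    have h0 := hpos 0
    have h1 := hpos 1
    have h2 := hpos 2
    have h3 := hpos 3
    have : d i = 1 := by fin_cases i <;> simp <;> omega
    simp [this]
  have a0 : (graph ι lam).Adj (v 0) (v 1) := hadj 0
  have a1 : (graph ι lam).Adj (v 1) (v 2) := hadj 1
  have a2 : (graph ι lam).Adj (v 2) (v 3) := hadj 2
  have a3 : (graph ι lam).Adj (v 3) (v 4) := hadj 3
  have r0 := rank_le_of_adj _ _ a0
  have r1 := rank_le_of_adj _ _ a1
  have r2 := rank_le_of_adj _ _ a2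
  have r3 := rank_le_of_adj _ _ a3
  have s0 : (v 0).rank = 0 := by rw [h0]; rfl
  have s4 : (v 4).rank = 4 := by rw [h1]; rfl
  exact ⟨cov_of_adj a1 (by omega), cov_of_adj a2 (by omega), by omega⟩

theorem cocycle_comp_boundary :
    cocycle ι lam ∘ₗ boundary (graph ι lam) 3 4 = 0 := by
  refine Finsupp.lhom_ext' fun v => LinearMap.ext_ring ?_
  simp only [LinearMap.comp_apply, Finsupp.lsingle_apply, LinearMap.zero_apply]
  rw [boundary_single, map_sum]
  simp only [map_smul, faceChain_eq_tupleChain]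
  by_cases h : v.1 0 = bot ∧ v.1 4 = top
  · obtain ⟨c1, c2, hr⟩ := cov_of_isEulerianPath v.2 h.1 h.2
    have hf := isEulerianPath_face_of_bot_top v.2 h.1 h.2
    have t0 : tupleLabel ι lam (face (0 : Fin 3) v.1) = label ι lam (v.1 2) (v.1 3) := if_pos h
    have t1 : tupleLabel ι lam (face (1 : Fin 3) v.1) = label ι lam (v.1 1) (v.1 3) := if_pos h
    have t2 : tupleLabel ι lam (face (2 : Fin 3) v.1) = label ι lam (v.1 1) (v.1 2) := if_pos h
    rw [Fin.sum_univ_three, cocycle_tupleChain (hf 0), cocycle_tupleChain (hf 1),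
      cocycle_tupleChain (hf 2), t0, t1, t2, ← label_add c1 c2 hr]
    simp only [Fin.val_zero, Fin.val_one, Fin.val_two]
    module
  -- Interior faces keep both endpoints, so every face also fails to run from `bot` to `top`.
  · refine Finset.sum_eq_zero fun i _ => ?_
    have ht : tupleLabel ι lam (face i v.1) = 0 := by
      refine if_neg fun h' => h ?_
      fin_cases i <;> exact h'
    by_cases hv : IsEulerianPath (graph ι lam) (face i v.1) ∧
        len (graph ι lam) (face i v.1) = (4 : ℕ)
    · rw [cocycle_tupleChain hv, ht, smul_zero]
    · rw [tupleChain, dif_neg hv, map_zero, smul_zero]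

theorem cocycle_edgeChain (hpq : Cov ι lam p q) (hqr : Cov ι lam q r) (hp : p.rank = 1) :
    cocycle ι lam (edgeChain ι lam p q) = label ι lam p q := by
  rw [edgeChain, cocycle_tupleChain (isEulerianPath_edge hpq hqr hp)]
  exact if_pos ⟨rfl, rfl⟩

/-! ### Loops and their relations -/

/-- The loop through `base`, `arc j false`, `side j` and `arc j true`. -/
noncomputable def loopChain (ι : I → A) (lam : J → A) (j : J) : EMC (graph ι lam) 3 4 :=
  edgeChain ι lam base (arc j false) - edgeChain ι lam (side j) (arc j false) +
    (edgeChain ι lam (side j) (arc j true) - edgeChain ι lam base (arc j true))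

theorem loopChain_mem_cycles [Nonempty I] (j : J) :
    loopChain ι lam j ∈ cycles (graph ι lam) 3 4 := by
  obtain ⟨i⟩ := ‹Nonempty I›
  change boundary (graph ι lam) 2 4 _ = 0
  have hb := fun ε => boundary_edgeChain (Cov.base_arc (ι := ι) (lam := lam) j ε)
    (.arc_roof j i ε) rfl
  have hs := fun ε => boundary_edgeChain (Cov.side_arc (ι := ι) (lam := lam) j ε)
    (.arc_roof j i ε) rfl
  simp only [loopChain, map_add, map_sub, hb, hs]
  abel

theorem cocycle_loopChain [Nonempty I] (j : J) :
    cocycle ι lam (loopChain ι lam j) = lam j := by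
  obtain ⟨i⟩ := ‹Nonempty I›
  have hb := fun ε => cocycle_edgeChain (Cov.base_arc (ι := ι) (lam := lam) j ε)
    (.arc_roof j i ε) rfl
  have hs := fun ε => cocycle_edgeChain (Cov.side_arc (ι := ι) (lam := lam) j ε)
    (.arc_roof j i ε) rfl
  simp only [loopChain, map_add, map_sub, hb, hs]
  simp [label]

/-- The loop is pushed across triangles: from the arcs up to the two roofs over `i`, from `side j`
to `apex` through `link j i`, and from `base` to `apex` through `node i` on one side and `node k` on
the other. -/
theorem mkQ_loopChain {j : J} {i k : I} (h : ι k = ι i + lam j) :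
    (LinearMap.range (boundary (graph ι lam) 3 4)).mkQ (loopChain ι lam j) =
      (LinearMap.range (boundary (graph ι lam) 3 4)).mkQ
        (edgeChain ι lam base (node i) - edgeChain ι lam apex (node i)) -
      (LinearMap.range (boundary (graph ι lam) 3 4)).mkQ
        (edgeChain ι lam base (node k) - edgeChain ι lam apex (node k)) := by
  have a1 := fun ε => mkQ_edgeChain_add (Cov.base_arc (ι := ι) (lam := lam) j ε)
    (.arc_roof j i ε) rfl
  have a2 := fun ε => mkQ_edgeChain_add (Cov.side_arc (ι := ι) (lam := lam) j ε)
    (.arc_roof j i ε) rfl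
  have a3 := fun ε => mkQ_edgeChain_add (Cov.side_link (ι := ι) (lam := lam) j i)
    (.link_roof j i ε) rfl
  have a4 := fun ε => mkQ_edgeChain_add (Cov.apex_link (ι := ι) (lam := lam) j i)
    (.link_roof j i ε) rfl
  have b1 := mkQ_edgeChain_add (Cov.base_node (ι := ι) (lam := lam) i) (.node_false j i) rfl
  have b2 := mkQ_edgeChain_add (Cov.base_node (ι := ι) (lam := lam) k) (.node_true j i k h) rfl
  have b3 := mkQ_edgeChain_add (Cov.apex_node (ι := ι) (lam := lam) i) (.node_false j i) rfl
  have b4 := mkQ_edgeChain_add (Cov.apex_node (ι := ι) (lam := lam) k) (.node_true j i k h) rfl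
  simp only [loopChain, map_add, map_sub]
  -- After these substitutions every edge cancels except those joining `node i` and `node k` to
  -- `base` and `apex`.
  rw [eq_sub_of_add_eq (a1 false), eq_sub_of_add_eq (a1 true), eq_sub_of_add_eq (a2 false),
    eq_sub_of_add_eq (a2 true), ← a3 false, ← a3 true, ← b1, ← b2,
    eq_sub_of_add_eq' (a4 true), eq_sub_of_add_eq' (a4 false),
    eq_sub_of_add_eq' b3, eq_sub_of_add_eq' b4]
  abel

/-- The homology class of the loop of `j`. -/
noncomputable def loopClass [Nonempty I] (ι : I → A) (lam : J → A) (j : J) :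
    EMH (graph ι lam) 3 4 := homologyClass ⟨loopChain ι lam j, loopChain_mem_cycles j⟩

theorem loopClass_add [Nonempty I] {j₁ j₂ j : J} {i₀ i₁ i₂ : I} (h₁ : ι i₁ = ι i₀ + lam j₁)
    (h₂ : ι i₂ = ι i₁ + lam j₂) (h : ι i₂ = ι i₀ + lam j) :
    loopClass ι lam j = loopClass ι lam j₁ + loopClass ι lam j₂ := by
  rw [loopClass, loopClass, loopClass, ← map_add, homologyClass_eq_iff,
    ← Submodule.Quotient.mk_eq_zero, ← Submodule.mkQ_apply, map_sub]
  simp only [Submodule.coe_add, map_add, mkQ_loopChain h, mkQ_loopChain h₁, mkQ_loopChain h₂]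
  abel

end Vertex

/-! ### Embedding the group -/

open Vertex in
theorem exists_injective_free_prod (n : ℕ) (T : Type) [AddCommGroup T] [Finite T] :
    ∃ (V : Type) (_ : Finite V) (G : SimpleGraph V) (f : (Fin n →₀ ℤ) × T →+ EMH G 3 4),
      Function.Injective f := by
  -- Positions cover only the finite factor, which keeps the graph finite. The free generators need
  -- no relations, so their loops need no positions to connect.
  let ι : T → (Fin n →₀ ℤ) × T := fun t => (0, t)
  let lam : Fin n ⊕ T → (Fin n →₀ ℤ) × T := Sum.elim (fun i => (Finsupp.single i 1, 0)) ι
  let f₁ : (Fin n →₀ ℤ) →+ EMH (graph ι lam) 3 4 :=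
    (Finsupp.lift _ ℤ (Fin n) fun i => loopClass ι lam (.inl i)).toAddMonoidHom
  let f₂ : T →+ EMH (graph ι lam) 3 4 :=
    AddMonoidHom.mk' (fun t => loopClass ι lam (.inr t)) fun s t =>
      -- The positions `0`, `s`, `s + t` are joined by the loops of `s`, of `t` and of `s + t`.
      loopClass_add (i₀ := 0) (i₁ := s) (i₂ := s + t) (by simp [ι, lam]) (by simp [ι, lam])
        (by simp [ι, lam])
  let g := homologyEval (cocycle ι lam) cocycle_comp_boundary
  have hg : ∀ j, g (loopClass ι lam j) = lam j := cocycle_loopChain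
  refine ⟨_, inferInstance, graph ι lam, f₁.coprod f₂,
    Function.LeftInverse.injective (g := g) ?_⟩
  have hid : g.toAddMonoidHom.comp (f₁.coprod f₂) = AddMonoidHom.id _ := by
    ext i
    all_goals simp [f₁, f₂, hg, lam, ι, Prod.fst_sum, Prod.snd_sum]
  exact DFunLike.congr_fun hid

end EulerianMagnitude

theorem theorem3 (A : Type*) [AddCommGroup A] [AddGroup.FG A] :
    ∃ (V : Type) (_ : Finite V) (G : SimpleGraph V) (k ℓ : ℕ), 0 < k ∧ 0 < ℓ ∧
      ∃ f : A →+ EulerianMagnitude.EMH G k ℓ, Function.Injective f := by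
  obtain ⟨n, ι, _, p, hp, e, ⟨φ⟩⟩ := AddCommGroup.equiv_free_prod_directSum_zmod A
  classical
  have : ∀ i, NeZero (p i ^ e i) := fun i => ⟨pow_ne_zero _ (hp i).ne_zero⟩
  have : Finite (DirectSum ι fun i => ZMod (p i ^ e i)) :=
    Finite.of_equiv _ (DirectSum.addEquivProd fun i => ZMod (p i ^ e i)).symm.toEquiv
  obtain ⟨V, hV, G, f, hf⟩ := EulerianMagnitude.exists_injective_free_prod n
    (DirectSum ι fun i => ZMod (p i ^ e i))
  exact ⟨V, hV, G, 3, 4, by norm_num, by norm_num, f.comp φ.toAddMonoidHom,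
    hf.comp φ.injective⟩
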